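/- Let $(\Omega,\mathcal F,\mathbb P)$ be a probability space, $(S,\Sigma,\nu)$ a $\sigma$-finite measure space, $T>0$, and let $p$ be a Poisson random measure on $S_T:=S\times[0,T]$ with intensity measure $\mu=\nu\otimes\lambda$, where $\lambda$ is the Lebesgue measure on $[0,T]$: for every $\omega$, $p(\omega,\cdot)$ is a $\mathbb Z_+\cup\{\infty\}$-valued measure; for every measurable $B$, $p(B)$ is a random variable that is Poisson distributed with parameter $\mu(B)\in[0,\infty]$; and $p(B_1),\dots,p(B_M)$ are independent for pairwise disjoint measurable $B_1,\dots,B_M$. For a real separable Hilbert space $H$, a cylindrical random variable is one of the form $$F=\sum_{i=1}^n f_i(p(B_1),\dots,p(B_M))\,h_i$$ with $M,n\in\mathbb N$, pairwise disjoint measurable sets $B_1,\dots,B_M\subset S_T$ of finite $\mu$-measure, functions $f_i:\mathbb Z_+^M\to\mathbb R$ and $h_i\in H$. Writing $\mathbf B=(B_1,\dots,B_M)$, $p(\mathbf B)=(p(B_1),\dots,p(B_M))$ and $e_m$ for the $m$-th unit vector, its Malliavin derivative is $$DF=\sum_{i=1}^n\sum_{m=1}^M\bigl(f_i(p(\mathbf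 B)+e_m)-f_i(p(\mathbf B))\bigr)\mathbf 1_{B_m}h_i .$$ The operator $D$, defined on the cylindrical $F\in L^2(\Omega;H)$ with $DF\in L^2(\Omega\times S_T;H)$, where $\Omega\times S_T$ carries the measure $\mathbb P\otimes\mu$, is closable from $L^2(\Omega;H)$ to $L^2(\Omega\times S_T;H)$. Its closure is again denoted by $D$, with domain $\mathbb D^{1,2}(\Omega;H)$. **Proposition (chain rule).** Let $H,\tilde H$ be real separable Hilbert spaces, $\varphi:H\to\tilde H$ Lipschitz continuous and $F\in\mathbb D^{1,2}(\Omega;H)$. Then $\varphi(F)\in\mathbb D^{1,2}(\Omega;\tilde H)$ and $$D\varphi(F)=\varphi(F+DF)-\varphi(F)\qquad \mathbb P\otimes\mu\text{-almost everywhere on }\Omega\times S_T .$$ -/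

import Mathlib

open MeasureTheory ProbabilityTheory
open scoped ENNReal NNReal

noncomputable section

namespace PoissonMalliavin

/-- The Poisson distribution with parameter `r ∈ [0, ∞]`, as a law on `[0, ∞]` carried by
`ℕ ∪ {∞}`; for `r = ∞` it is the point mass at `∞`. -/
def extPoisson (r : ℝ≥0∞) : Measure ℝ≥0∞ :=
  if r = ∞ then Measure.dirac ∞
  else (poissonMeasure r.toNNReal).map (fun k : ℕ => (k : ℝ≥0∞))

/-- `p` is a Poisson random measure on `E` with intensity measure `μ`, on the probability
space `(Ω, P)`. That `p ω` is a measure for every `ω` is part of the type of `p`. -/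
structure IsPoissonRandomMeasure {Ω E : Type*} [MeasurableSpace Ω] [MeasurableSpace E]
    (p : Ω → Measure E) (μ : Measure E) (P : Measure Ω) : Prop where
  /-- The values are in `ℕ ∪ {∞}`. -/
  integerValued : ∀ ω, ∀ B, MeasurableSet B → ∃ k : ℕ∞, p ω B = (k : ℝ≥0∞)
  /-- `p(B)` is a random variable. -/
  measurable_apply : ∀ B, MeasurableSet B → Measurable (fun ω => p ω B)
  /-- `p(B)` is Poisson distributed with parameter `μ(B)`. -/
  law : ∀ B, MeasurableSet B → P.map (fun ω => p ω B) = extPoisson (μ B)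
  /-- The values on pairwise disjoint measurable sets are independent. -/
  indep : ∀ (M : ℕ) (B : Fin M → Set E), (∀ m, MeasurableSet (B m)) →
    Pairwise (fun i j => Disjoint (B i) (B j)) → iIndepFun (fun m ω => p ω (B m)) P

/-- The vector `p(𝐁) = (p(B₁), …, p(B_M))` of natural numbers. The floor only extracts the
natural number from an element of `[0, ∞]`; the value `p ω (B m) = ∞`, which has probability
zero when `B m` has finite intensity, is sent to `0`. -/
def counts {Ω E : Type*} [MeasurableSpace E] (p : Ω → Measure E) {M : ℕ} (B : Fin M → Set E)
    (ω : Ω) : Fin M → ℕ :=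
  fun m => ⌊(p ω (B m)).toReal⌋₊

/-- The data of a cylindrical random variable `∑ i, fᵢ(p(B₁), …, p(B_M)) hᵢ`, with pairwise
disjoint measurable sets `B₁, …, B_M` of finite intensity. -/
structure CylData {E : Type*} [MeasurableSpace E] (μ : Measure E) (H : Type*) where
  M : ℕ
  n : ℕ
  B : Fin M → Set E
  f : Fin n → (Fin M → ℕ) → ℝ
  h : Fin n → H
  measurableSet_B : ∀ m, MeasurableSet (B m)
  measure_B_lt_top : ∀ m, μ (B m) < ∞
  disjoint_B : Pairwise (fun i j => Disjoint (B i) (B j))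

namespace CylData

variable {Ω E : Type*} [MeasurableSpace E] {μ : Measure E}
  {H : Type*} [NormedAddCommGroup H] [InnerProductSpace ℝ H]

/-- The cylindrical random variable `∑ i, fᵢ(p(𝐁)) hᵢ`. -/
def toFun (c : CylData μ H) (p : Ω → Measure E) (ω : Ω) : H :=
  ∑ i, c.f i (counts p c.B ω) • c.h i

/-- Its Malliavin derivative `∑ i, ∑ m, (fᵢ(p(𝐁) + eₘ) - fᵢ(p(𝐁))) 1_{Bₘ} hᵢ`, a function on
`Ω × E`. -/
def deriv (c : CylData μ H) (p : Ω → Measure E) (z : Ω × E) : H :=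
  ∑ i, ∑ m, (c.B m).indicator (fun _ =>
    (c.f i (counts p c.B z.1 + Pi.single m 1) - c.f i (counts p c.B z.1)) • c.h i) z.2

end CylData

section Operator

variable {Ω E : Type*} [MeasurableSpace Ω] [MeasurableSpace E]
  (H : Type*) [NormedAddCommGroup H] [InnerProductSpace ℝ H]
  (p : Ω → Measure E) (μ : Measure E) (P : Measure Ω)

/-- The pairs `(F, DF) ∈ L²(Ω; H) × L²(Ω × E; H)` with `F` cylindrical. By passing to common
refinements of the sets `B₁, …, B_M` these pairs form a linear subspace; taking the span adds
nothing and only records this. -/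
def cylGraph : Submodule ℝ (Lp H 2 P × Lp H 2 (P.prod μ)) :=
  Submodule.span ℝ {x | ∃ c : CylData μ H,
    x.1 =ᵐ[P] c.toFun p ∧ x.2 =ᵐ[P.prod μ] c.deriv p}

/-- The Malliavin derivative on cylindrical random variables, as an unbounded operator from
`L²(Ω; H)` to `L²(Ω × E; H)`. -/
def malliavinCyl : Lp H 2 P →ₗ.[ℝ] Lp H 2 (P.prod μ) :=
  (cylGraph H p μ P).toLinearPMap

/-- The Malliavin derivative `D`: the closure of the derivative on cylindrical random variables.
Its domain is the space `𝔻^{1,2}(Ω; H)`. -/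
def malliavin : Lp H 2 P →ₗ.[ℝ] Lp H 2 (P.prod μ) :=
  (malliavinCyl H p μ P).closure

/-- The space `𝔻^{1,2}(Ω; H)`, the domain of `D`. -/
def D12 : Submodule ℝ (Lp H 2 P) := (malliavin H p μ P).domain

variable {H p μ P}

/-- The Malliavin derivative `DF ∈ L²(Ω × E; H)` of `F ∈ 𝔻^{1,2}(Ω; H)`. -/
def D (F : Lp H 2 P) (hF : F ∈ D12 H p μ P) : Lp H 2 (P.prod μ) :=
  malliavin H p μ P ⟨F, hF⟩

end Operator

/-- The intensity measure `ν ⊗ λ` on `S × [0, T]`, with `λ` the Lebesgue measure. -/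
def intensity {S : Type*} [MeasurableSpace S] (ν : Measure S) (T : ℝ) :
    Measure (S × Set.Icc (0 : ℝ) T) :=
  ν.prod ((volume : Measure ℝ).comap Subtype.val)

end PoissonMalliavin

end

/-!
For a measure `ρ` on `E` and a point `x`, adding `x` means passing from `ρ` to `ρ + δ_x`. On a
cylindrical random variable `F = f(p)` the Malliavin derivative is the difference
`f(p + δ_x) - f(p)` (`CylData.deriv_eq_sub`), and for such a difference the chain rule is an
identity: `φ(F) + Dφ(F) = φ(f(p + δ_x)) = φ(F + DF)`. The proof makes this description available
on the whole domain of `D`.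

The law of `p + δ_x`, with `x` distributed according to `μ`, is absolutely continuous with respect
to the law of `p` (`IsPoissonRandomMeasure.map_add_dirac_absolutelyContinuous`). This follows from
the Mecke formula `E ∫_A g(p + δ_x) μ(dx) = E [p(A) g(p)]`, which on cylinder sets reduces to the
identity `r E g(X + 1) = E [X g(X)]` for a Poisson variable `X` with parameter `r`. Hence
`f(p + δ_x) - f(p)` depends only on the almost sure class of `F = f(p)`, and the description
`DF = f(p + δ_x) - f(p)` survives limits in `L²`, along subsequences that converge almost
everywhere. In particular `D` is well defined and closable, and its graph is the closure of the
cylindrical pairs (`IsPoissonRandomMeasure.graph_malliavin`).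

It remains to see that `(φ(F), φ(F + DF) - φ(F))` lies in this closure. If `F` is cylindrical,
then `φ(F)` is a function of the counts on finitely many disjoint sets, its projections to
finite-dimensional subspaces are cylindrical, and they converge by dominated convergence
(`IsPoissonRandomMeasure.mem_closure_of_dependsOnFinitelyMany`). The general case follows because
the pair depends continuously on `(F, DF)` (`tendsto_chainPair`).
-/

namespace PoissonMalliavin

open Filter Topology

/-! ### The Mecke formula -/

theorem lintegral_poissonMeasure (r : ℝ≥0) (g : ℕ → ℝ≥0∞) :
    ∫⁻ k, g k ∂poissonMeasure r
      = ∑' k : ℕ, ENNReal.ofReal (Real.exp (-r) * r ^ k / k.factorial) * g k := by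
  simp [poissonMeasure, lintegral_sum_measure]

/-- The identity `r E g(X + 1) = E [X g(X)]`, which characterizes the Poisson distribution. -/
theorem mul_lintegral_add_one_poissonMeasure (r : ℝ≥0) (g : ℕ → ℝ≥0∞) :
    r * ∫⁻ k, g (k + 1) ∂poissonMeasure r = ∫⁻ k, k * g k ∂poissonMeasure r := by
  rw [lintegral_poissonMeasure, lintegral_poissonMeasure, ← ENNReal.tsum_mul_left,
    tsum_eq_zero_add' (f := fun k : ℕ => _ * ((k : ℝ≥0∞) * g k)) ENNReal.summable]
  rw [Nat.cast_zero, zero_mul, mul_zero, zero_add]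
  refine tsum_congr fun k => ?_
  rw [← mul_assoc, ← mul_assoc]
  congr 1
  rw [← ENNReal.ofReal_coe_nnreal, ← ENNReal.ofReal_natCast,
    ← ENNReal.ofReal_mul (by positivity), ← ENNReal.ofReal_mul (by positivity)]
  congr 1
  rw [Nat.factorial_succ]
  push_cast
  field_simp
  rw [pow_succ']

theorem mul_lintegral_add_one_extPoisson {r : ℝ≥0∞} (hr : r ≠ ∞) {g : ℝ≥0∞ → ℝ≥0∞}
    (hg : Measurable g) :
    r * ∫⁻ x, g (x + 1) ∂extPoisson r = ∫⁻ x, x * g x ∂extPoisson r := by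
  rw [extPoisson, if_neg hr, lintegral_map (by fun_prop) (by fun_prop),
    lintegral_map (by fun_prop) (by fun_prop)]
  have := mul_lintegral_add_one_poissonMeasure r.toNNReal (fun k => g k)
  rw [ENNReal.coe_toNNReal hr] at this
  simpa using this

theorem extPoisson_singleton_top {r : ℝ≥0∞} (hr : r ≠ ∞) : extPoisson r {∞} = 0 := by
  rw [extPoisson, if_neg hr, Measure.map_apply (by fun_prop) (by simp)]
  convert measure_empty (μ := poissonMeasure r.toNNReal)
  ext k
  simp

/-- The Poisson identity in one coordinate `s` of a family of independent variables: the
remaining coordinates are integrated out by Fubini. -/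
theorem mul_lintegral_add_single_of_iIndepFun {Ω κ : Type*} [MeasurableSpace Ω] {P : Measure Ω}
    [IsProbabilityMeasure P] [Fintype κ] [DecidableEq κ] {X : κ → Ω → ℝ≥0∞}
    (hX : ∀ t, Measurable (X t)) (hind : iIndepFun X P) {s : κ} {r : ℝ≥0∞} (hr : r ≠ ∞)
    (hs : P.map (X s) = extPoisson r) {g : (κ → ℝ≥0∞) → ℝ≥0∞} (hg : Measurable g) :
    r * ∫⁻ ω, g ((fun t => X t ω) + Pi.single s 1) ∂P
      = ∫⁻ ω, X s ω * g (fun t => X t ω) ∂P := by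
  -- `Y` collects the coordinates other than `s`, with the coordinate `s` set to zero.
  let Y : Ω → κ → ℝ≥0∞ := fun ω t => if t = s then 0 else X t ω
  have hY : Measurable Y := by
    refine measurable_pi_lambda _ fun t => ?_
    by_cases h : t = s
    · simp [Y, h]
    · simpa [Y, h] using hX t
  have hXY : IndepFun (X s) Y P := by
    have h := hind.indepFun_finset {s} (Finset.univ.erase s) (by simp) hX
    have hφ : Measurable fun x : ({s} : Finset κ) → ℝ≥0∞ => x ⟨s, by simp⟩ :=
      measurable_pi_apply (X := fun _ : ({s} : Finset κ) => ℝ≥0∞) _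
    have h' := h.comp (φ := fun x : ({s} : Finset κ) → ℝ≥0∞ => x ⟨s, by simp⟩)
      (ψ := fun y t => if ht : t ∈ Finset.univ.erase s then y ⟨t, ht⟩ else 0)
      hφ (by
        refine measurable_pi_lambda _ fun t => ?_
        by_cases ht : t ∈ Finset.univ.erase s
        · simp only [ht, dite_true]; exact measurable_pi_apply _
        · simp only [ht, dite_false]; exact measurable_const)
    convert h' using 1
    · rfl
    · funext ω t
      by_cases ht : t = s <;> simp [Y, ht]
  have hsplit : ∀ ω, (fun t => X t ω) = Y ω + Pi.single s (X s ω) := by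
    intro ω
    ext t
    by_cases ht : t = s
    · subst ht; simp [Y]
    · simp [Y, ht]
  have hsing : Measurable (fun x : ℝ≥0∞ => (Pi.single s x : κ → ℝ≥0∞)) := measurable_pi_lambda _
    fun t => by
      by_cases ht : t = s
      · subst ht; simpa using measurable_id'
      · simp [ht]
  have hmap := (indepFun_iff_map_prod_eq_prod_map_map (hX s).aemeasurable hY.aemeasurable).1 hXY
  have hprod : ∀ h : ℝ≥0∞ × (κ → ℝ≥0∞) → ℝ≥0∞, Measurable h →
      ∫⁻ ω, h (X s ω, Y ω) ∂P = ∫⁻ y, ∫⁻ x, h (x, y) ∂extPoisson r ∂P.map Y := by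
    intro h hh
    have : IsProbabilityMeasure (P.map (X s)) :=
      Measure.isProbabilityMeasure_map (hX s).aemeasurable
    have : IsProbabilityMeasure (P.map Y) := Measure.isProbabilityMeasure_map hY.aemeasurable
    rw [← lintegral_map (f := h) hh ((hX s).prodMk hY), hmap, lintegral_prod_symm' _ hh, hs]
  have : IsProbabilityMeasure (extPoisson r) :=
    hs ▸ Measure.isProbabilityMeasure_map (hX s).aemeasurable
  calc r * ∫⁻ ω, g ((fun t => X t ω) + Pi.single s 1) ∂P
      = r * ∫⁻ ω, g (Y ω + Pi.single s (X s ω + 1)) ∂P := by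
        simp_rw [Pi.single_add, ← add_assoc, ← hsplit]
    _ = ∫⁻ y, r * ∫⁻ x, g (y + Pi.single s (x + 1)) ∂extPoisson r ∂P.map Y := by
        have hm : Measurable fun z : ℝ≥0∞ × (κ → ℝ≥0∞) => g (z.2 + Pi.single s (z.1 + 1)) :=
          hg.comp (measurable_snd.add (hsing.comp (measurable_fst.add_const 1)))
        rw [hprod _ hm, lintegral_const_mul _ hm.lintegral_prod_left']
    _ = ∫⁻ y, ∫⁻ x, x * g (y + Pi.single s x) ∂extPoisson r ∂P.map Y := by
        congr 1 with y
        exact mul_lintegral_add_one_extPoisson hr (g := fun x => g (y + Pi.single s x))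
          (by fun_prop)
    _ = ∫⁻ ω, X s ω * g (fun t => X t ω) ∂P := by
        have hm : Measurable fun z : ℝ≥0∞ × (κ → ℝ≥0∞) => z.1 * g (z.2 + Pi.single s z.1) :=
          measurable_fst.mul (hg.comp (measurable_snd.add (hsing.comp measurable_fst)))
        rw [← hprod _ hm]
        simp_rw [hsplit]

section Atoms

variable {E ι : Type*}

/-- The points that lie in exactly those members of the family `C` whose index is in `s`. For
nonempty `s` these are the atoms of the common refinement of the sets `C i`. -/
def atom (C : ι → Set E) (s : Finset ι) : Set E := {x | ∀ i, x ∈ C i ↔ i ∈ s}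

theorem disjoint_atom (C : ι → Set E) {s t : Finset ι} (h : s ≠ t) :
    Disjoint (atom C s) (atom C t) := by
  rw [Set.disjoint_left]
  intro x hs ht
  exact h (Finset.ext fun i => (hs i).symm.trans (ht i))

theorem atom_subset {C : ι → Set E} {s : Finset ι} {i : ι} (hi : i ∈ s) : atom C s ⊆ C i :=
  fun _ hx => (hx i).2 hi

variable [MeasurableSpace E] [Fintype ι]

theorem measurableSet_atom {C : ι → Set E} (hC : ∀ i, MeasurableSet (C i)) (s : Finset ι) :
    MeasurableSet (atom C s) := by
  have : atom C s = ⋂ i, {x | x ∈ C i ↔ i ∈ s} := by ext; simp [atom]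
  rw [this]
  refine MeasurableSet.iInter fun i => ?_
  by_cases hi : i ∈ s
  · simpa [hi] using hC i
  · simp only [hi, iff_false]; exact (hC i).compl

open Classical in
theorem measure_eq_sum_atom {C : ι → Set E} (hC : ∀ i, MeasurableSet (C i)) (m : Measure E)
    (i : ι) : m (C i) = ∑ s : {s : Finset ι // s.Nonempty},
      if i ∈ s.1 then m (atom C s.1) else 0 := by
  rw [← Finset.sum_filter, ← measure_biUnion_finset]
  · congr 1
    ext x
    simp only [Finset.mem_filter, Finset.mem_univ, true_and, Set.mem_iUnion, exists_prop,
      Subtype.exists]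
    constructor
    · intro hx
      refine ⟨Finset.univ.filter (fun j => x ∈ C j), ⟨i, by simpa using hx⟩, by simpa using hx, ?_⟩
      intro j
      simp
    · rintro ⟨s, _, his, hxs⟩
      exact atom_subset his hxs
  · intro s _ t _ hst
    exact disjoint_atom C (fun h => hst (Subtype.ext h))
  · intro s _
    exact measurableSet_atom hC s.1

end Atoms

section Mecke

variable {Ω E : Type*} [MeasurableSpace Ω] [MeasurableSpace E] {P : Measure Ω}
  {μ : Measure E} {p : Ω → Measure E}

theorem IsPoissonRandomMeasure.measurable (hp : IsPoissonRandomMeasure p μ P) : Measurable p :=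
  Measure.measurable_of_measurable_coe _ fun _ hB => hp.measurable_apply _ hB

theorem measurable_add_dirac (hp : Measurable p) :
    Measurable (fun z : Ω × E => p z.1 + Measure.dirac z.2) :=
  (hp.comp measurable_fst).add (Measure.measurable_dirac.comp measurable_snd)

theorem IsPoissonRandomMeasure.ae_lt_top (hp : IsPoissonRandomMeasure p μ P) {B : Set E}
    (hB : MeasurableSet B) (hμ : μ B ≠ ∞) : ∀ᵐ ω ∂P, p ω B < ∞ := by
  have h := extPoisson_singleton_top hμ
  rw [← hp.law B hB, Measure.map_apply (hp.measurable_apply B hB) (by simp)] at h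
  filter_upwards [measure_eq_zero_iff_ae_notMem.1 h] with ω hω
  exact lt_top_iff_ne_top.2 hω

open Classical in
/-- The Mecke formula for functions of finitely many values `p(C i)`. On each atom of the
refinement of the `C i` it is the Poisson identity in one of the independent coordinates. -/
theorem IsPoissonRandomMeasure.lintegral_add_dirac_cylinder [IsProbabilityMeasure P]
    [SigmaFinite μ]
    (hp : IsPoissonRandomMeasure p μ P) {ι : Type*} [Fintype ι] {C : ι → Set E}
    (hC : ∀ i, MeasurableSet (C i)) {i₀ : ι} (h₀ : μ (C i₀) ≠ ∞) {g : (ι → ℝ≥0∞) → ℝ≥0∞}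
    (hg : Measurable g) :
    ∫⁻ z, g (fun i => (p z.1 + Measure.dirac z.2) (C i)) ∂(P.prod (μ.restrict (C i₀)))
      = ∫⁻ ω, p ω (C i₀) * g (fun i => p ω (C i)) ∂P := by
  let κ := {s : Finset ι // s.Nonempty}
  let X : κ → Ω → ℝ≥0∞ := fun s ω => p ω (atom C s.1)
  have hX : ∀ s, Measurable (X s) := fun s => hp.measurable_apply _ (measurableSet_atom hC _)
  have hind : iIndepFun X P := by
    let e := Fintype.equivFin κ
    have h := hp.indep (Fintype.card κ) (fun m => atom C (e.symm m).1)
      (fun m => measurableSet_atom hC _)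
      (fun i j hij => disjoint_atom C fun h => hij (e.symm.injective (Subtype.ext h)))
    convert h.precomp e.injective using 2 with s
    simp [X]
  -- `L` recovers the values on the `C i` from those on the atoms.
  let L : (κ → ℝ≥0∞) → ι → ℝ≥0∞ := fun y i => ∑ s : κ, if i ∈ s.1 then y s else 0
  have hL : Measurable L := by
    refine measurable_pi_lambda _ fun i => Finset.measurable_sum _ fun s _ => ?_
    by_cases h : i ∈ s.1
    · simpa [h] using measurable_pi_apply s
    · simp [h]
  have hLm : ∀ m : Measure E, (fun i => m (C i)) = L (fun s => m (atom C s.1)) := fun m =>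
    funext fun i => measure_eq_sum_atom hC m i
  have hrestrict : μ.restrict (C i₀)
      = ∑ s : κ, if i₀ ∈ s.1 then μ.restrict (atom C s.1) else 0 := by
    ext B hB
    rw [Measure.restrict_apply hB, Set.inter_comm, ← Measure.restrict_apply (hC i₀),
      measure_eq_sum_atom hC, Measure.coe_finsetSum, Finset.sum_apply]
    refine Finset.sum_congr rfl fun s _ => ?_
    by_cases h : i₀ ∈ s.1
    · simp [h, hB, measurableSet_atom hC, Set.inter_comm]
    · simp [h]
  have hmeas : Measurable fun z : Ω × E => g (fun i => (p z.1 + Measure.dirac z.2) (C i)) := by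
    refine hg.comp (measurable_pi_lambda _ fun i => ?_)
    exact (Measure.measurable_coe (hC i)).comp (measurable_add_dirac hp.measurable)
  have hterm : ∀ s : κ, i₀ ∈ s.1 →
      ∫⁻ x in atom C s.1, ∫⁻ ω, g (fun i => (p ω + Measure.dirac x) (C i)) ∂P ∂μ
        = ∫⁻ ω, X s ω * g (fun i => p ω (C i)) ∂P := by
    intro s hs
    have hfin : μ (atom C s.1) ≠ ∞ := ne_top_of_le_ne_top h₀ (measure_mono (atom_subset hs))
    have hconst : ∀ x ∈ atom C s.1, ∫⁻ ω, g (fun i => (p ω + Measure.dirac x) (C i)) ∂P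
        = ∫⁻ ω, g (L ((fun t => X t ω) + Pi.single s 1)) ∂P := by
      intro x hx
      congr 1 with ω
      rw [hLm]
      congr 2
      ext t
      rw [Measure.add_apply, Pi.add_apply, Measure.dirac_apply' _ (measurableSet_atom hC _)]
      congr 1
      by_cases hts : t = s
      · subst hts; simp [hx]
      · have : x ∉ atom C t.1 := fun hxt =>
          (Set.disjoint_left.1 (disjoint_atom C (fun h => hts (Subtype.ext h))) hxt hx)
        simp [hts, this]
    rw [setLIntegral_congr_fun (measurableSet_atom hC _) hconst, setLIntegral_const, mul_comm]
    refine (mul_lintegral_add_single_of_iIndepFun hX hind hfin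
        (hp.law _ (measurableSet_atom hC _)) (hg.comp hL)).trans ?_
    simp_rw [hLm]
    rfl
  rw [lintegral_prod_symm' _ hmeas, hrestrict, lintegral_finsetSum_measure]
  have hgp : Measurable fun ω => g (fun i => p ω (C i)) :=
    hg.comp (measurable_pi_lambda _ fun i => hp.measurable_apply _ (hC i))
  simp_rw [measure_eq_sum_atom hC (p _) i₀, Finset.sum_mul]
  rw [lintegral_finsetSum]
  · refine Finset.sum_congr rfl fun s _ => ?_
    by_cases h : i₀ ∈ s.1
    · simpa [h] using hterm s h
    · simp [h]
  · intro s _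
    by_cases h : i₀ ∈ s.1
    · simp only [h, if_true]; exact (hX s).mul hgp
    · simp [h]

/-- The Mecke formula, as an equality of measures on the space of measures on `E`. The cylinder
sets form a generating `π`-system. -/
theorem IsPoissonRandomMeasure.map_add_dirac_prod_restrict [IsProbabilityMeasure P]
    [SigmaFinite μ]
    (hp : IsPoissonRandomMeasure p μ P) {A : Set E} (hA : MeasurableSet A) (hμA : μ A ≠ ∞) :
    (P.prod (μ.restrict A)).map (fun z => p z.1 + Measure.dirac z.2)
      = (P.withDensity (fun ω => p ω A)).map p := by
  classical
  have : IsFiniteMeasure (μ.restrict A) := ⟨by simpa using hμA.lt_top⟩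
  have hτ := measurable_add_dirac (E := E) hp.measurable
  let π : Set E → Set (Set (Measure E)) := fun B =>
    {s | MeasurableSet[(borel ℝ≥0∞).comap fun m : Measure E => m B] s}
  have key : ∀ s ∈ piiUnionInter π {B | MeasurableSet B},
      (P.prod (μ.restrict A)).map (fun z => p z.1 + Measure.dirac z.2) s
        = (P.withDensity (fun ω => p ω A)).map p s := by
    rintro s ⟨t, ht, f, hf, rfl⟩
    choose! V hV hVf using hf
    -- The set `A` joins the finitely many sets of the cylinder as the index `none`.
    let C : Option t → Set E := fun i => i.elim A (fun B => B.1)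
    have hC : ∀ i, MeasurableSet (C i) := by
      rintro (_ | B)
      · exact hA
      · exact ht B.2
    let W : Set (Option t → ℝ≥0∞) := {y | ∀ B : t, y (some B) ∈ V B.1}
    have hVm : ∀ B ∈ t, MeasurableSet (V B) := fun B hB => by
      have := hV B hB
      rwa [← BorelSpace.measurable_eq (α := ℝ≥0∞)] at this
    have hW : MeasurableSet W := by
      have : W = ⋂ B : t, (fun y : Option t → ℝ≥0∞ => y (some B)) ⁻¹' V B.1 := by
        ext; simp [W]
      rw [this]
      exact MeasurableSet.iInter fun B => measurable_pi_apply _ (hVm B.1 B.2)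
    have hset : (⋂ B ∈ t, f B) = (fun m : Measure E => fun i => m (C i)) ⁻¹' W := by
      ext m
      simp only [Set.mem_iInter, Set.mem_preimage, W, Set.mem_ofPred_eq, C, Option.elim,
        Subtype.forall]
      refine forall₂_congr fun B hB => ?_
      rw [← hVf B hB]
      rfl
    have heval : Measurable (fun m : Measure E => fun i => m (C i)) :=
      measurable_pi_lambda _ fun i => Measure.measurable_coe (hC i)
    have h := hp.lintegral_add_dirac_cylinder hC (i₀ := none) hμA
      (g := W.indicator 1) (measurable_one.indicator hW)
    rw [hset, Measure.map_apply hτ (heval hW), Measure.map_apply hp.measurable (heval hW),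
      withDensity_apply _ (hp.measurable (heval hW)), ← lintegral_indicator_one (hτ (heval hW)),
      ← lintegral_indicator (hp.measurable (heval hW))]
    refine Eq.trans ?_ (h.trans ?_)
    · rfl
    · congr 1 with ω
      by_cases hω : (fun i => p ω (C i)) ∈ W
      · have h2 : ω ∈ p ⁻¹' ((fun m : Measure E => fun i => m (C i)) ⁻¹' W) := hω
        rw [Set.indicator_of_mem hω, Set.indicator_of_mem h2]
        simp [C]
      · have h2 : ω ∉ p ⁻¹' ((fun m : Measure E => fun i => m (C i)) ⁻¹' W) := hω
        rw [Set.indicator_of_notMem hω, Set.indicator_of_notMem h2]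
        simp
  have hgen : (Measure.instMeasurableSpace : MeasurableSpace (Measure E))
      = MeasurableSpace.generateFrom (piiUnionInter π {B | MeasurableSet B}) :=
    (generateFrom_piiUnionInter_measurableSet
      (fun B : Set E => (borel ℝ≥0∞).comap fun m : Measure E => m B) {B | MeasurableSet B}).symm
  refine ext_of_generate_finite _ hgen
    (isPiSystem_piiUnionInter _ (fun B => @MeasurableSpace.isPiSystem_measurableSet _
      ((borel ℝ≥0∞).comap fun m : Measure E => m B)) _) key ?_
  -- The empty intersection is the whole space, so the total masses agree.
  exact key _ ⟨∅, by simp, fun _ => Set.univ, by simp, by simp⟩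

/-- Adding a point distributed according to the intensity is an absolutely continuous operation
on the law of a Poisson random measure. -/
theorem IsPoissonRandomMeasure.map_add_dirac_absolutelyContinuous
    [IsProbabilityMeasure P] [SigmaFinite μ]
    (hp : IsPoissonRandomMeasure p μ P) :
    (P.prod μ).map (fun z => p z.1 + Measure.dirac z.2) ≪ P.map p := by
  have hτ := measurable_add_dirac (E := E) hp.measurable
  refine Measure.AbsolutelyContinuous.mk fun N hN h0 => ?_
  rw [Measure.map_apply hτ hN]
  have hcover : (fun z : Ω × E => p z.1 + Measure.dirac z.2) ⁻¹' N
      = ⋃ n, (fun z : Ω × E => p z.1 + Measure.dirac z.2) ⁻¹' N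
          ∩ Set.univ ×ˢ spanningSets μ n := by
    rw [← Set.inter_iUnion, ← Set.prod_iUnion, iUnion_spanningSets]
    simp
  rw [hcover]
  refine measure_iUnion_null fun n => ?_
  have h := congrArg (fun m => m N) (hp.map_add_dirac_prod_restrict
    (measurableSet_spanningSets μ n) (measure_spanningSets_lt_top μ n).ne)
  rw [Measure.map_apply hp.measurable hN] at h0
  rw [Measure.map_apply hτ hN, Measure.map_apply hp.measurable hN,
    withDensity_absolutelyContinuous _ _ h0] at h
  rwa [← Measure.restrict_univ (μ := P), Measure.prod_restrict, Measure.restrict_apply (hτ hN)]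
    at h

end Mecke

/-! ### Convergence in `L²` -/

section Convergence

variable {α β : Type*} [MeasurableSpace α] [MeasurableSpace β] {μ : Measure α} {ν : Measure β}
  {H : Type*} [NormedAddCommGroup H]

theorem tendsto_Lp_two_of_dominated {u : ℕ → Lp H 2 μ} {v : Lp H 2 μ} {g : α → ℝ}
    (hg : MemLp g 2 μ) (hbound : ∀ n, ∀ᵐ x ∂μ, ‖u n x - v x‖ ≤ g x)
    (hlim : ∀ᵐ x ∂μ, Tendsto (fun n => u n x) atTop (𝓝 (v x))) :
    Tendsto u atTop (𝓝 v) := by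
  rw [Lp.tendsto_Lp_iff_tendsto_eLpNorm']
  have hfin := lintegral_rpow_enorm_lt_top_of_eLpNorm_lt_top two_ne_zero ENNReal.ofNat_ne_top
    hg.eLpNorm_lt_top
  have h : Tendsto (fun n => ∫⁻ x, ‖u n x - v x‖ₑ ^ (2 : ℝ≥0∞).toReal ∂μ) atTop
      (𝓝 (∫⁻ _, 0 ∂μ)) := by
    refine tendsto_lintegral_of_dominated_convergence'
      (fun x => ‖g x‖ₑ ^ (2 : ℝ≥0∞).toReal) (fun n => ?_) (fun n => ?_) hfin.ne ?_
    · exact (((Lp.aestronglyMeasurable (u n)).sub (Lp.aestronglyMeasurable v)).enorm).pow_const _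
    · filter_upwards [hbound n] with x hx
      gcongr
      rw [enorm_le_iff_norm_le]
      exact hx.trans (le_abs_self _)
    · filter_upwards [hlim] with x hx
      have h0 : Tendsto (fun n => ‖u n x - v x‖ₑ) atTop (𝓝 0) := by
        have := (hx.sub_const (v x)).enorm
        simpa using this
      have := h0.ennrpow_const (2 : ℝ≥0∞).toReal
      simpa using this
  rw [lintegral_zero] at h
  have h' := h.ennrpow_const (1 / (2 : ℝ≥0∞).toReal)
  rw [ENNReal.zero_rpow_of_pos (by norm_num)] at h'
  refine h'.congr fun n => ?_
  rw [eLpNorm_eq_lintegral_rpow_enorm_toReal two_ne_zero ENNReal.ofNat_ne_top]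
  rfl

theorem exists_seq_tendsto_ae_of_mem_closure {s : Set (Lp H 2 μ × Lp H 2 ν)}
    {x : Lp H 2 μ × Lp H 2 ν} (hx : x ∈ closure s) :
    ∃ u : ℕ → Lp H 2 μ × Lp H 2 ν, (∀ n, u n ∈ s) ∧ Tendsto u atTop (𝓝 x) ∧
      (∀ᵐ a ∂μ, Tendsto (fun n => (u n).1 a) atTop (𝓝 (x.1 a))) ∧
      ∀ᵐ b ∂ν, Tendsto (fun n => (u n).2 b) atTop (𝓝 (x.2 b)) := by
  obtain ⟨u, hu, hux⟩ := mem_closure_iff_seq_limit.1 hx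
  obtain ⟨k, hk, hk'⟩ := (tendstoInMeasure_of_tendsto_Lp
    ((continuous_fst.tendsto x).comp hux)).exists_seq_tendsto_ae
  have hux' := hux.comp hk.tendsto_atTop
  obtain ⟨l, hl, hl'⟩ := (tendstoInMeasure_of_tendsto_Lp
    ((continuous_snd.tendsto x).comp hux')).exists_seq_tendsto_ae
  refine ⟨fun n => u (k (l n)), fun n => hu _, hux'.comp hl.tendsto_atTop, ?_, hl'⟩
  filter_upwards [hk'] with a ha
  exact ha.comp hl.tendsto_atTop

end Convergence

/-! ### Difference operators on functionals of the random measure -/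

section ShiftDifference

variable {Ω E : Type*} [MeasurableSpace Ω] [MeasurableSpace E] {p : Ω → Measure E}
  {μ : Measure E} {P : Measure Ω} {H : Type*} [NormedAddCommGroup H]

variable (p μ P) in
/-- `F` is a measurable functional `f(p)` of the random measure, and `G` is the difference
`f(p + δ_x) - f(p)` obtained by adding a point `x` to it. -/
def IsShiftDifference (F : Ω → H) (G : Ω × E → H) : Prop :=
  ∃ f : Measure E → H, StronglyMeasurable f ∧ F =ᵐ[P] (fun ω => f (p ω)) ∧
    G =ᵐ[P.prod μ] fun z => f (p z.1 + Measure.dirac z.2) - f (p z.1)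

theorem IsPoissonRandomMeasure.ae_add_dirac [IsProbabilityMeasure P] [SigmaFinite μ]
    (hp : IsPoissonRandomMeasure p μ P) {q : Measure E → Prop} (hq : MeasurableSet {m | q m})
    (h : ∀ᵐ ω ∂P, q (p ω)) : ∀ᵐ z ∂(P.prod μ), q (p z.1 + Measure.dirac z.2) := by
  have h1 : ∀ᵐ m ∂(P.map p), q m := (ae_map_iff hp.measurable.aemeasurable hq).2 h
  exact ae_of_ae_map (measurable_add_dirac hp.measurable).aemeasurable
    (hp.map_add_dirac_absolutelyContinuous h1)

theorem ae_fst_of_ae [SFinite μ] {q : Ω → Prop} (h : ∀ᵐ ω ∂P, q ω) :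
    ∀ᵐ z ∂(P.prod μ), q z.1 :=
  Measure.quasiMeasurePreserving_fst.ae h

/-- The difference does not depend on the functional representing `F`, since the law of
`p + δ_x` is absolutely continuous with respect to the law of `p`. -/
theorem IsPoissonRandomMeasure.shiftDifference_eq [IsProbabilityMeasure P] [SigmaFinite μ]
    (hp : IsPoissonRandomMeasure p μ P) {F : Ω → H} {G : Ω × E → H}
    (h : IsShiftDifference p μ P F G) {g : Measure E → H} (hg : StronglyMeasurable g)
    (hF : F =ᵐ[P] fun ω => g (p ω)) :
    G =ᵐ[P.prod μ] fun z => g (p z.1 + Measure.dirac z.2) - g (p z.1) := by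
  obtain ⟨f, hf, hFf, hG⟩ := h
  have h1 : ∀ᵐ ω ∂P, f (p ω) = g (p ω) := hFf.symm.trans hF
  filter_upwards [hG, ae_fst_of_ae (μ := μ) h1,
    hp.ae_add_dirac (hf.measurableSet_eq_fun hg) h1] with z h2 h3 h4
  rw [h2, h3, h4]

theorem IsShiftDifference.congr {F F' : Ω → H} {G G' : Ω × E → H}
    (h : IsShiftDifference p μ P F G) (hF : F' =ᵐ[P] F) (hG : G' =ᵐ[P.prod μ] G) :
    IsShiftDifference p μ P F' G' := by
  obtain ⟨f, hf, h1, h2⟩ := h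
  exact ⟨f, hf, hF.trans h1, hG.trans h2⟩

theorem IsShiftDifference.add {F F' : Ω → H} {G G' : Ω × E → H}
    (h : IsShiftDifference p μ P F G) (h' : IsShiftDifference p μ P F' G') :
    IsShiftDifference p μ P (F + F') (G + G') := by
  obtain ⟨f, hf, h1, h2⟩ := h
  obtain ⟨f', hf', h1', h2'⟩ := h'
  refine ⟨f + f', hf.add hf', h1.add h1', (h2.add h2').trans (.of_forall fun z => ?_)⟩
  simp only [Pi.add_apply]
  abel

theorem IsShiftDifference.const_smul [NormedSpace ℝ H] {F : Ω → H} {G : Ω × E → H}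
    (h : IsShiftDifference p μ P F G) (c : ℝ) : IsShiftDifference p μ P (c • F) (c • G) := by
  obtain ⟨f, hf, h1, h2⟩ := h
  refine ⟨c • f, hf.const_smul c, h1.const_smul c,
    (h2.const_smul c).trans (.of_forall fun z => ?_)⟩
  simp only [Pi.smul_apply, smul_sub]

theorem isShiftDifference_zero : IsShiftDifference p μ P (0 : Ω → H) (0 : Ω × E → H) :=
  ⟨0, stronglyMeasurable_zero, .rfl, .of_forall fun z => by simp⟩

theorem IsPoissonRandomMeasure.isShiftDifference_of_tendsto_ae [IsProbabilityMeasure P]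
    [SigmaFinite μ] [CompleteSpace H] (hp : IsPoissonRandomMeasure p μ P) {F : ℕ → Ω → H}
    {G : ℕ → Ω × E → H} {F' : Ω → H} {G' : Ω × E → H}
    (h : ∀ n, IsShiftDifference p μ P (F n) (G n))
    (hF : ∀ᵐ ω ∂P, Tendsto (fun n => F n ω) atTop (𝓝 (F' ω)))
    (hG : ∀ᵐ z ∂(P.prod μ), Tendsto (fun n => G n z) atTop (𝓝 (G' z))) :
    IsShiftDifference p μ P F' G' := by
  choose f hf hFf hGf using h
  have hFf' := ae_all_iff.2 hFf
  have hconv : ∀ᵐ m ∂(P.map p), ∃ l, Tendsto (fun n => f n m) atTop (𝓝 l) := by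
    rw [ae_map_iff hp.measurable.aemeasurable
      (StronglyMeasurable.measurableSet_exists_tendsto hf)]
    filter_upwards [hF, hFf'] with ω h1 h2
    exact ⟨F' ω, by simpa only [h2] using h1⟩
  obtain ⟨g, hg, hlim⟩ := exists_stronglyMeasurable_limit_of_tendsto_ae
    (fun n => (hf n).aestronglyMeasurable) hconv
  have h1 : ∀ᵐ ω ∂P, Tendsto (fun n => f n (p ω)) atTop (𝓝 (g (p ω))) :=
    ae_of_ae_map hp.measurable.aemeasurable hlim
  have h2 : ∀ᵐ z ∂(P.prod μ), Tendsto (fun n => f n (p z.1 + Measure.dirac z.2)) atTop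
      (𝓝 (g (p z.1 + Measure.dirac z.2))) :=
    ae_of_ae_map (measurable_add_dirac hp.measurable).aemeasurable
      (hp.map_add_dirac_absolutelyContinuous hlim)
  refine ⟨g, hg, ?_, ?_⟩
  · filter_upwards [h1, hF, hFf'] with ω h1 h3 h4
    simp only [h4] at h3
    exact tendsto_nhds_unique h3 h1
  · filter_upwards [h2, ae_fst_of_ae (μ := μ) h1, hG, ae_all_iff.2 hGf] with z h2 h1 h3 h4
    simp only [h4] at h3
    exact tendsto_nhds_unique h3 (h2.sub h1)

end ShiftDifference

/-! ### Cylindrical random variables -/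

section Cylindrical

variable {Ω E : Type*} [MeasurableSpace E] {p : Ω → Measure E} {μ : Measure E}

theorem measurable_counts {M : ℕ} {B : Fin M → Set E} (hB : ∀ m, MeasurableSet (B m)) :
    Measurable (fun m : Measure E => counts id B m) :=
  measurable_pi_lambda _ fun i => Nat.measurable_floor.comp
    (ENNReal.measurable_toReal.comp (Measure.measurable_coe (hB i)))

theorem stronglyMeasurable_comp_counts {H : Type*} [TopologicalSpace H] {M : ℕ}
    {B : Fin M → Set E} (hB : ∀ m, MeasurableSet (B m)) (ψ : (Fin M → ℕ) → H) :
    StronglyMeasurable (fun m : Measure E => ψ (counts id B m)) :=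
  StronglyMeasurable.of_discrete.comp_measurable (measurable_counts hB)

theorem counts_add_dirac_of_mem {M : ℕ} {B : Fin M → Set E} (hB : ∀ m, MeasurableSet (B m))
    (hd : Pairwise fun i j => Disjoint (B i) (B j)) {ρ : Measure E} (hρ : ∀ m, ρ (B m) < ∞)
    {x : E} {j : Fin M} (hx : x ∈ B j) :
    counts id B (ρ + Measure.dirac x) = counts id B ρ + Pi.single j 1 := by
  ext i
  simp only [counts, id, Measure.add_apply, Measure.dirac_apply' x (hB i), Pi.add_apply]
  by_cases hi : i = j
  · subst hi
    simp [hx, ENNReal.toReal_add (hρ i).ne, Nat.floor_add_one]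
  · have : x ∉ B i := fun h => Set.disjoint_left.1 (hd hi) h hx
    simp [this, hi]

theorem counts_add_dirac_of_notMem {M : ℕ} {B : Fin M → Set E} (hB : ∀ m, MeasurableSet (B m))
    {ρ : Measure E} {x : E} (hx : ∀ m, x ∉ B m) :
    counts id B (ρ + Measure.dirac x) = counts id B ρ := by
  ext i
  simp [counts, Measure.dirac_apply' x (hB i), hx i]

variable {H : Type*} [NormedAddCommGroup H] [InnerProductSpace ℝ H]

/-- The Malliavin derivative of a cylindrical random variable is the effect of adding a point. -/
theorem CylData.deriv_eq_sub (c : CylData μ H) {ω : Ω} (hω : ∀ m, p ω (c.B m) < ∞) (x : E) :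
    c.deriv p (ω, x) = c.toFun id (p ω + Measure.dirac x) - c.toFun id (p ω) := by
  simp only [CylData.deriv, CylData.toFun, ← Finset.sum_sub_distrib, ← sub_smul]
  refine Finset.sum_congr rfl fun i _ => ?_
  by_cases hx : ∃ j, x ∈ c.B j
  · obtain ⟨j, hj⟩ := hx
    rw [Finset.sum_eq_single j, Set.indicator_of_mem hj,
      counts_add_dirac_of_mem c.measurableSet_B c.disjoint_B hω hj]
    · rfl
    · intro m _ hm
      exact Set.indicator_of_notMem (fun h => Set.disjoint_left.1 (c.disjoint_B hm) h hj) _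
    · simp
  · push Not at hx
    rw [counts_add_dirac_of_notMem c.measurableSet_B hx, sub_self, zero_smul]
    exact Finset.sum_eq_zero fun m _ => Set.indicator_of_notMem (hx m) _

variable [MeasurableSpace Ω] {P : Measure Ω}

theorem IsPoissonRandomMeasure.isShiftDifference_cylData [SFinite μ]
    (hp : IsPoissonRandomMeasure p μ P) (c : CylData μ H) :
    IsShiftDifference p μ P (c.toFun p) (c.deriv p) := by
  refine ⟨c.toFun id, stronglyMeasurable_comp_counts c.measurableSet_B
    (fun k => ∑ i, c.f i k • c.h i), .rfl, ?_⟩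
  have h : ∀ᵐ ω ∂P, ∀ m, p ω (c.B m) < ∞ :=
    ae_all_iff.2 fun m => hp.ae_lt_top (c.measurableSet_B m) (c.measure_B_lt_top m).ne
  filter_upwards [ae_fst_of_ae (μ := μ) h] with z hz
  exact c.deriv_eq_sub hz z.2

variable [SigmaFinite μ]

theorem IsPoissonRandomMeasure.isShiftDifference_of_mem_cylGraph
    (hp : IsPoissonRandomMeasure p μ P) {x : Lp H 2 P × Lp H 2 (P.prod μ)}
    (hx : x ∈ cylGraph H p μ P) : IsShiftDifference p μ P x.1 x.2 := by
  induction hx using Submodule.span_induction with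
  | mem x hx =>
    obtain ⟨c, h1, h2⟩ := hx
    exact (hp.isShiftDifference_cylData c).congr h1 h2
  | zero => exact isShiftDifference_zero.congr (Lp.coeFn_zero _ _ _) (Lp.coeFn_zero _ _ _)
  | add x y _ _ hx hy =>
    exact (hx.add hy).congr (Lp.coeFn_add _ _) (Lp.coeFn_add _ _)
  | smul a x _ hx =>
    exact (hx.const_smul a).congr (Lp.coeFn_smul _ _) (Lp.coeFn_smul _ _)

variable [IsProbabilityMeasure P]

theorem IsPoissonRandomMeasure.isShiftDifference_of_mem_closure [CompleteSpace H]
    (hp : IsPoissonRandomMeasure p μ P) {x : Lp H 2 P × Lp H 2 (P.prod μ)}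
    (hx : x ∈ (cylGraph H p μ P).topologicalClosure) : IsShiftDifference p μ P x.1 x.2 := by
  obtain ⟨u, hu, -, h1, h2⟩ := exists_seq_tendsto_ae_of_mem_closure hx
  exact hp.isShiftDifference_of_tendsto_ae
    (fun n => hp.isShiftDifference_of_mem_cylGraph (hu n)) h1 h2

/-- The Malliavin derivative on cylindrical random variables is well defined and closable. -/
theorem IsPoissonRandomMeasure.graph_malliavin [CompleteSpace H]
    (hp : IsPoissonRandomMeasure p μ P) :
    (malliavin H p μ P).graph = (cylGraph H p μ P).topologicalClosure := by
  have key : ∀ x ∈ (cylGraph H p μ P).topologicalClosure, x.1 = 0 → x.2 = 0 := by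
    intro x hx h0
    have h := hp.shiftDifference_eq (hp.isShiftDifference_of_mem_closure hx)
      (g := fun _ => 0) stronglyMeasurable_const (by rw [h0]; exact Lp.coeFn_zero _ _ _)
    exact (Lp.eq_zero_iff_ae_eq_zero).2 (h.trans (by simp; rfl))
  have h1 : (malliavinCyl H p μ P).graph = cylGraph H p μ P :=
    Submodule.toLinearPMap_graph_eq _
      fun x hx => key x ((cylGraph H p μ P).le_topologicalClosure hx)
  have h2 : (malliavinCyl H p μ P).IsClosable :=
    ⟨(cylGraph H p μ P).topologicalClosure.toLinearPMap, by
      rw [h1, Submodule.toLinearPMap_graph_eq _ key]⟩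
  rw [malliavin, ← h2.graph_closure_eq_closure_graph, h1]

end Cylindrical

/-! ### Common refinement of cylindrical random variables -/

section Refinement

variable {Ω E : Type*} [MeasurableSpace Ω] [MeasurableSpace E] {p : Ω → Measure E}
  {μ : Measure E} {P : Measure Ω} {H : Type*}

variable (p μ P) in
/-- `F` is almost surely a function of the values of `p` on finitely many sets of finite
intensity, which need not be disjoint. The function `ψ` is arbitrary; its measurability
is automatic on the integer values that `p` takes. -/
def DependsOnFinitelyMany (F : Ω → H) : Prop :=
  ∃ (ι : Type) (_ : Fintype ι) (C : ι → Set E) (ψ : (ι → ℝ≥0∞) → H),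
    (∀ i, MeasurableSet (C i)) ∧ (∀ i, μ (C i) < ∞) ∧ F =ᵐ[P] fun ω => ψ (fun i => p ω (C i))

theorem DependsOnFinitelyMany.congr {F F' : Ω → H} (h : DependsOnFinitelyMany p μ P F)
    (hF : F' =ᵐ[P] F) : DependsOnFinitelyMany p μ P F' := by
  obtain ⟨ι, hι, C, ψ, hC, hμ, h⟩ := h
  exact ⟨ι, hι, C, ψ, hC, hμ, hF.trans h⟩

theorem DependsOnFinitelyMany.map {H' : Type*} {F : Ω → H} (h : DependsOnFinitelyMany p μ P F)
    (φ : H → H') : DependsOnFinitelyMany p μ P (fun ω => φ (F ω)) := by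
  obtain ⟨ι, hι, C, ψ, hC, hμ, h⟩ := h
  exact ⟨ι, hι, C, φ ∘ ψ, hC, hμ, h.fun_comp φ⟩

theorem DependsOnFinitelyMany.add [Add H] {F F' : Ω → H} (h : DependsOnFinitelyMany p μ P F)
    (h' : DependsOnFinitelyMany p μ P F') : DependsOnFinitelyMany p μ P (F + F') := by
  obtain ⟨ι, hι, C, ψ, hC, hμ, h⟩ := h
  obtain ⟨ι', hι', C', ψ', hC', hμ', h'⟩ := h'
  exact ⟨ι ⊕ ι', inferInstance, Sum.elim C C',
    fun y => ψ (fun i => y (.inl i)) + ψ' (fun i => y (.inr i)),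
    Sum.rec hC hC', Sum.rec hμ hμ', h.add h'⟩

/-- Passing to the atoms of the common refinement makes the sets disjoint. -/
theorem IsPoissonRandomMeasure.exists_counts_of_dependsOnFinitelyMany
    (hp : IsPoissonRandomMeasure p μ P) {F : Ω → H} (h : DependsOnFinitelyMany p μ P F) :
    ∃ (M : ℕ) (B : Fin M → Set E) (ψ : (Fin M → ℕ) → H), (∀ m, MeasurableSet (B m)) ∧
      (∀ m, μ (B m) < ∞) ∧ Pairwise (fun i j => Disjoint (B i) (B j)) ∧
      F =ᵐ[P] fun ω => ψ (counts p B ω) := by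
  classical
  obtain ⟨ι, _, C, ψ, hC, hμ, hF⟩ := h
  let κ := {s : Finset ι // s.Nonempty}
  let e := Fintype.equivFin κ
  let B : Fin (Fintype.card κ) → Set E := fun m => atom C (e.symm m).1
  have hB : ∀ m, MeasurableSet (B m) := fun m => measurableSet_atom hC _
  have hμB : ∀ m, μ (B m) < ∞ := fun m => by
    obtain ⟨i, hi⟩ := (e.symm m).2
    exact (measure_mono (atom_subset hi)).trans_lt (hμ i)
  -- On finite integer values the truncation in `counts` is the identity.
  refine ⟨_, B, fun k => ψ (fun i => ∑ s : κ, if i ∈ s.1 then (k (e s) : ℝ≥0∞) else 0), hB, hμB,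
    fun i j hij => disjoint_atom C fun h => hij (e.symm.injective (Subtype.ext h)), ?_⟩
  filter_upwards [hF, ae_all_iff.2 fun m => hp.ae_lt_top (hB m) (hμB m).ne] with ω hω hfin
  rw [hω]
  congr 1 with i
  rw [measure_eq_sum_atom hC]
  refine Finset.sum_congr rfl fun s _ => ?_
  have hs : atom C s.1 = B (e s) := by simp [B]
  have : p ω (B (e s)) = (counts p B ω (e s) : ℝ≥0∞) := by
    obtain ⟨k, hk⟩ := hp.integerValued ω (B (e s)) (hB _)
    have hlt := hfin (e s)
    simp only [counts]
    rw [hk] at hlt ⊢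
    obtain ⟨n, rfl⟩ := ENat.ne_top_iff_exists.1
      (show k ≠ ⊤ by rintro rfl; simp at hlt)
    simp
  rw [hs, this]

end Refinement

section Lipschitz

variable {Ω E : Type*} [MeasurableSpace Ω] [MeasurableSpace E] {p : Ω → Measure E}
  {μ : Measure E} {P : Measure Ω} {H H' : Type*} [NormedAddCommGroup H] [NormedAddCommGroup H']
  {φ : H → H'} {K : ℝ≥0}

theorem dependsOnFinitelyMany_of_mem_cylGraph [InnerProductSpace ℝ H]
    {x : Lp H 2 P × Lp H 2 (P.prod μ)} (hx : x ∈ cylGraph H p μ P) :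
    DependsOnFinitelyMany p μ P x.1 := by
  induction hx using Submodule.span_induction with
  | mem x hx =>
    obtain ⟨c, h1, -⟩ := hx
    exact ⟨Fin c.M, inferInstance, c.B, fun y => ∑ i, c.f i (fun m => ⌊(y m).toReal⌋₊) • c.h i,
      c.measurableSet_B, c.measure_B_lt_top, h1⟩
  | zero =>
    exact ⟨Empty, inferInstance, Empty.rec, fun _ => 0, fun i => i.elim, fun i => i.elim,
      Lp.coeFn_zero _ _ _⟩
  | add x y _ _ hx hy => exact (hx.add hy).congr (Lp.coeFn_add _ _)
  | smul a x _ hx => exact (hx.map (a • ·)).congr (Lp.coeFn_smul _ _)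

/-! ### The chain rule -/

theorem memLp_lipschitz_comp [IsFiniteMeasure P] (hφ : LipschitzWith K φ) {F : Ω → H}
    (hF : MemLp F 2 P) : MemLp (fun ω => φ (F ω)) 2 P := by
  have h : LipschitzWith K fun x => φ x - φ 0 := fun x y => by
    simpa [edist_sub_right] using hφ x y
  have := (h.comp_memLp (by simp) hF).add (memLp_const (φ 0))
  refine this.ae_eq (.of_forall fun ω => ?_)
  simp

theorem norm_lipschitz_add_sub_le (hφ : LipschitzWith K φ) (a b : H) :
    ‖φ (a + b) - φ a‖ ≤ K * ‖b‖ := by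
  simpa using hφ.norm_sub_le (a + b) a

theorem memLp_lipschitz_add_sub [SFinite P] [SFinite μ] (hφ : LipschitzWith K φ) {F : Ω → H}
    {G : Ω × E → H} (hF : AEStronglyMeasurable F P) (hG : MemLp G 2 (P.prod μ)) :
    MemLp (fun z => φ (F z.1 + G z) - φ (F z.1)) 2 (P.prod μ) := by
  refine hG.of_le_mul (c := K) ?_ (.of_forall fun z => norm_lipschitz_add_sub_le hφ _ _)
  have h1 : AEStronglyMeasurable (fun z : Ω × E => F z.1) (P.prod μ) := hF.comp_fst
  exact (hφ.continuous.comp_aestronglyMeasurable (h1.add hG.1)).sub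
    (hφ.continuous.comp_aestronglyMeasurable h1)

/-- The pair `(φ(F), φ(F + G) - φ(F))` attached to a pair `(F, G)`. -/
noncomputable def chainPair [IsFiniteMeasure P] [SFinite μ] (hφ : LipschitzWith K φ)
    (x : Lp H 2 P × Lp H 2 (P.prod μ)) : Lp H' 2 P × Lp H' 2 (P.prod μ) :=
  ((memLp_lipschitz_comp hφ (Lp.memLp x.1)).toLp,
    (memLp_lipschitz_add_sub hφ (Lp.aestronglyMeasurable x.1) (Lp.memLp x.2)).toLp)

theorem chainPair_fst_ae [IsFiniteMeasure P] [SFinite μ] (hφ : LipschitzWith K φ)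
    (x : Lp H 2 P × Lp H 2 (P.prod μ)) :
    (chainPair hφ x).1 =ᵐ[P] fun ω => φ (x.1 ω) :=
  (memLp_lipschitz_comp hφ (Lp.memLp x.1)).coeFn_toLp

theorem chainPair_snd_ae [IsFiniteMeasure P] [SFinite μ] (hφ : LipschitzWith K φ)
    (x : Lp H 2 P × Lp H 2 (P.prod μ)) :
    (chainPair hφ x).2 =ᵐ[P.prod μ] fun z => φ (x.1 z.1 + x.2 z) - φ (x.1 z.1) :=
  (memLp_lipschitz_add_sub hφ (Lp.aestronglyMeasurable x.1) (Lp.memLp x.2)).coeFn_toLp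

/-- Continuity of the chain rule along sequences whose first components converge almost
surely. In the second component `φ(Fₙ + Gₙ) - φ(Fₙ)` is compared with `φ(Fₙ + G) - φ(Fₙ)`, which
is dominated by a multiple of `G` although `μ` may be infinite. -/
theorem tendsto_chainPair [IsFiniteMeasure P] [SFinite μ] (hφ : LipschitzWith K φ)
    {u : ℕ → Lp H 2 P × Lp H 2 (P.prod μ)} {x : Lp H 2 P × Lp H 2 (P.prod μ)}
    (hu : Tendsto u atTop (𝓝 x))
    (hae : ∀ᵐ ω ∂P, Tendsto (fun n => (u n).1 ω) atTop (𝓝 (x.1 ω))) :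
    Tendsto (fun n => chainPair hφ (u n)) atTop (𝓝 (chainPair hφ x)) := by
  have hu1 : Tendsto (fun n => K * ‖(u n).1 - x.1‖) atTop (𝓝 0) := by
    have := (tendsto_iff_norm_sub_tendsto_zero.1 ((continuous_fst.tendsto x).comp hu)).const_mul
      (K : ℝ)
    simpa using this
  have hu2 : Tendsto (fun n => K * ‖(u n).2 - x.2‖) atTop (𝓝 0) := by
    have := (tendsto_iff_norm_sub_tendsto_zero.1 ((continuous_snd.tendsto x).comp hu)).const_mul
      (K : ℝ)
    simpa using this
  refine (Prod.tendsto_iff _ _).2 ⟨?_, ?_⟩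
  · rw [tendsto_iff_norm_sub_tendsto_zero]
    refine squeeze_zero (fun _ => norm_nonneg _) (fun n => ?_) hu1
    refine Lp.norm_le_mul_norm_of_ae_le_mul ?_
    filter_upwards [chainPair_fst_ae hφ (u n), chainPair_fst_ae hφ x,
      Lp.coeFn_sub (chainPair hφ (u n)).1 (chainPair hφ x).1, Lp.coeFn_sub (u n).1 x.1]
      with ω h1 h2 h3 h4
    rw [h3, h4, Pi.sub_apply, Pi.sub_apply, h1, h2]
    exact hφ.norm_sub_le _ _
  · let w : ℕ → Lp H' 2 (P.prod μ) := fun n => (chainPair hφ ((u n).1, x.2)).2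
    have hw : ∀ n, w n =ᵐ[P.prod μ] fun z => φ ((u n).1 z.1 + x.2 z) - φ ((u n).1 z.1) :=
      fun n => chainPair_snd_ae hφ ((u n).1, x.2)
    have hwlim : Tendsto w atTop (𝓝 (chainPair hφ x).2) := by
      refine tendsto_Lp_two_of_dominated (g := fun z => 2 * K * ‖x.2 z‖)
        ((Lp.memLp x.2).norm.const_mul _) (fun n => ?_) ?_
      · filter_upwards [hw n, chainPair_snd_ae hφ x] with z h1 h2
        rw [h1, h2]
        refine (norm_sub_le _ _).trans ?_
        have h3 := norm_lipschitz_add_sub_le hφ ((u n).1 z.1) (x.2 z)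
        have h4 := norm_lipschitz_add_sub_le hφ (x.1 z.1) (x.2 z)
        linarith
      · filter_upwards [ae_all_iff.2 hw, chainPair_snd_ae hφ x, ae_fst_of_ae (μ := μ) hae]
          with z h1 h2 h3
        simp only [h1, h2]
        exact ((hφ.continuous.tendsto _).comp (h3.add_const _)).sub
          ((hφ.continuous.tendsto _).comp h3)
    have hdiff : Tendsto (fun n => (chainPair hφ (u n)).2 - w n) atTop (𝓝 0) := by
      rw [tendsto_zero_iff_norm_tendsto_zero]
      refine squeeze_zero (fun _ => norm_nonneg _) (fun n => ?_) hu2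
      refine Lp.norm_le_mul_norm_of_ae_le_mul ?_
      filter_upwards [chainPair_snd_ae hφ (u n), hw n,
        Lp.coeFn_sub (chainPair hφ (u n)).2 (w n), Lp.coeFn_sub (u n).2 x.2]
        with z h1 h2 h3 h4
      rw [h3, h4, Pi.sub_apply, Pi.sub_apply, h1, h2, sub_sub_sub_cancel_right]
      simpa using hφ.norm_sub_le ((u n).1 z.1 + (u n).2 z) ((u n).1 z.1 + x.2 z)
    simpa using hdiff.add hwlim

theorem IsShiftDifference.chainPair [IsFiniteMeasure P] [SFinite μ] (hφ : LipschitzWith K φ)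
    {x : Lp H 2 P × Lp H 2 (P.prod μ)} (hx : IsShiftDifference p μ P x.1 x.2) :
    IsShiftDifference p μ P (chainPair hφ x).1 (chainPair hφ x).2 := by
  obtain ⟨f, hf, h1, h2⟩ := hx
  refine ⟨fun m => φ (f m), hφ.continuous.comp_stronglyMeasurable hf, ?_, ?_⟩
  · filter_upwards [chainPair_fst_ae hφ x, h1] with ω h3 h4
    rw [h3, h4]
  · filter_upwards [chainPair_snd_ae hφ x, ae_fst_of_ae (μ := μ) h1, h2] with z h3 h4 h5
    rw [h3, h4, h5, add_sub_cancel]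

/-- Finite-dimensional orthogonal projections converge strongly to the identity on a separable
Hilbert space. -/
theorem exists_seq_starProjection_tendsto (H : Type*) [NormedAddCommGroup H]
    [InnerProductSpace ℝ H] [TopologicalSpace.SeparableSpace H] :
    ∃ V : ℕ → Submodule ℝ H, ∃ _ : ∀ n, FiniteDimensional ℝ (V n),
      ∀ y, Tendsto (fun n => (V n).starProjection y) atTop (𝓝 y) := by
  let V : ℕ → Submodule ℝ H := fun n =>
    Submodule.span ℝ (TopologicalSpace.denseSeq H '' Set.Iic n)
  have hfin : ∀ n, FiniteDimensional ℝ (V n) := fun n =>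
    FiniteDimensional.span_of_finite ℝ ((Set.finite_Iic n).image _)
  refine ⟨V, hfin, fun y => Submodule.starProjection_tendsto_self V
    (fun m n hmn => Submodule.span_mono (Set.image_mono (Set.Iic_subset_Iic.2 hmn))) y ?_⟩
  intro z _
  refine closure_mono ?_ (TopologicalSpace.denseRange_denseSeq H z)
  rintro _ ⟨n, rfl⟩
  exact Submodule.mem_iSup_of_mem n
    (Submodule.subset_span (Set.mem_image_of_mem _ (Set.mem_Iic.2 le_rfl)))

theorem tendsto_compLp_starProjection {α H : Type*} [MeasurableSpace α] {m : Measure α}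
    [NormedAddCommGroup H] [InnerProductSpace ℝ H] {V : ℕ → Submodule ℝ H}
    [∀ n, (V n).HasOrthogonalProjection]
    (hlim : ∀ y, Tendsto (fun n => (V n).starProjection y) atTop (𝓝 y)) (v : Lp H 2 m) :
    Tendsto (fun n => (V n).starProjection.compLp v) atTop (𝓝 v) := by
  have hcoe : ∀ᵐ a ∂m, ∀ n, (V n).starProjection.compLp v a = (V n).starProjection (v a) :=
    ae_all_iff.2 fun n => (V n).starProjection.coeFn_compLp v
  refine tendsto_Lp_two_of_dominated (g := fun a => 2 * ‖v a‖)
    ((Lp.memLp v).norm.const_mul _) (fun n => ?_) ?_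
  · filter_upwards [hcoe] with a ha
    rw [ha]
    have := (V n).norm_starProjection_apply_le (v a)
    linarith [norm_sub_le ((V n).starProjection (v a)) (v a)]
  · filter_upwards [hcoe] with a ha
    simpa only [ha] using hlim (v a)

variable [InnerProductSpace ℝ H] [InnerProductSpace ℝ H']

/-- A square integrable difference pair whose first component is a function of finitely many
values of `p` lies in the closure of the cylindrical pairs: its projections to
finite-dimensional subspaces are cylindrical. -/
theorem IsPoissonRandomMeasure.mem_closure_of_dependsOnFinitelyMany [IsProbabilityMeasure P]
    [SigmaFinite μ] [TopologicalSpace.SeparableSpace H] (hp : IsPoissonRandomMeasure p μ P)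
    {y : Lp H 2 P × Lp H 2 (P.prod μ)} (hy : DependsOnFinitelyMany p μ P y.1)
    (hy' : IsShiftDifference p μ P y.1 y.2) : y ∈ (cylGraph H p μ P).topologicalClosure := by
  obtain ⟨M, B, ψ, hB, hμB, hd, hψ⟩ := hp.exists_counts_of_dependsOnFinitelyMany hy
  have hy2 := hp.shiftDifference_eq hy' (stronglyMeasurable_comp_counts hB ψ) hψ
  obtain ⟨V, hV, hlim⟩ := exists_seq_starProjection_tendsto H
  let c : ℕ → CylData μ H := fun n =>
    { M := M
      n := Module.finrank ℝ (V n)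
      B := B
      f := fun i k => inner ℝ (stdOrthonormalBasis ℝ (V n) i : H) (ψ k)
      h := fun i => stdOrthonormalBasis ℝ (V n) i
      measurableSet_B := hB
      measure_B_lt_top := hμB
      disjoint_B := hd }
  have hc : ∀ n (ρ : Measure E), (c n).toFun id ρ = (V n).starProjection (ψ (counts id B ρ)) := by
    intro n ρ
    rw [(stdOrthonormalBasis ℝ (V n)).starProjection_eq_sum_rankOne]
    simp [CylData.toFun, c]
  let u : ℕ → Lp H 2 P × Lp H 2 (P.prod μ) := fun n =>
    ((V n).starProjection.compLp y.1, (V n).starProjection.compLp y.2)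
  have hu : ∀ n, u n ∈ cylGraph H p μ P := by
    intro n
    refine Submodule.subset_span ⟨c n, ?_, ?_⟩
    · filter_upwards [(V n).starProjection.coeFn_compLp y.1, hψ] with ω h1 h2
      rw [h1, h2]
      exact (hc n (p ω)).symm
    · have hfin : ∀ᵐ ω ∂P, ∀ m, p ω (B m) < ∞ :=
        ae_all_iff.2 fun m => hp.ae_lt_top (hB m) (hμB m).ne
      filter_upwards [(V n).starProjection.coeFn_compLp y.2, hy2,
        ae_fst_of_ae (μ := μ) hfin] with z h1 h2 h3
      rw [h1, h2, map_sub, ← hc, ← hc]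
      exact ((c n).deriv_eq_sub h3 z.2).symm
  exact mem_closure_of_tendsto 
    ((tendsto_compLp_starProjection hlim y.1).prodMk_nhds
      (tendsto_compLp_starProjection hlim y.2)) (.of_forall hu)

theorem IsPoissonRandomMeasure.chainPair_mem_closure [IsProbabilityMeasure P] [SigmaFinite μ]
    [TopologicalSpace.SeparableSpace H'] (hp : IsPoissonRandomMeasure p μ P)
    (hφ : LipschitzWith K φ) {x : Lp H 2 P × Lp H 2 (P.prod μ)}
    (hx : x ∈ (cylGraph H p μ P).topologicalClosure) :
    chainPair hφ x ∈ (cylGraph H' p μ P).topologicalClosure := by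
  obtain ⟨u, hu, hux, hae, -⟩ := exists_seq_tendsto_ae_of_mem_closure hx
  refine (cylGraph H' p μ P).isClosed_topologicalClosure.mem_of_tendsto
    (tendsto_chainPair hφ hux hae) (.of_forall fun n => ?_)
  exact hp.mem_closure_of_dependsOnFinitelyMany
    (((dependsOnFinitelyMany_of_mem_cylGraph (hu n)).map φ).congr (chainPair_fst_ae hφ _))
    ((hp.isShiftDifference_of_mem_cylGraph (hu n)).chainPair hφ)

end Lipschitz

instance sigmaFinite_intensity {S : Type*} [MeasurableSpace S] (ν : Measure S) [SigmaFinite ν]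
    (T : ℝ) :
    SigmaFinite (intensity ν T) := by
  have : IsFiniteMeasure ((volume : Measure ℝ).comap (Subtype.val : Set.Icc (0 : ℝ) T → ℝ)) := by
    refine ⟨?_⟩
    rw [comap_subtype_coe_apply measurableSet_Icc]
    rw [Set.image_univ, Subtype.range_coe]
    exact measure_Icc_lt_top
  unfold intensity
  infer_instance

end PoissonMalliavin

theorem mainTheorem2
    {Ω : Type*} [MeasurableSpace Ω] (P : Measure Ω) [IsProbabilityMeasure P]
    {S : Type*} [MeasurableSpace S] (ν : Measure S) [SigmaFinite ν]
    (T : ℝ) (hT : 0 < T)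
    (p : Ω → Measure (S × Set.Icc (0 : ℝ) T))
    (hp : PoissonMalliavin.IsPoissonRandomMeasure p (PoissonMalliavin.intensity ν T) P)
    {H : Type*} [NormedAddCommGroup H] [InnerProductSpace ℝ H] [CompleteSpace H]
    [TopologicalSpace.SeparableSpace H]
    {H' : Type*} [NormedAddCommGroup H'] [InnerProductSpace ℝ H'] [CompleteSpace H']
    [TopologicalSpace.SeparableSpace H']
    (φ : H → H') (K : ℝ≥0) (hφ : LipschitzWith K φ)
    (F : Lp H 2 P)
    (hF : F ∈ PoissonMalliavin.D12 H p (PoissonMalliavin.intensity ν T) P) :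
    ∃ (hL : MemLp (fun ω => φ (F ω)) 2 P)
      (hD : hL.toLp ∈ PoissonMalliavin.D12 H' p (PoissonMalliavin.intensity ν T) P),
      ∀ᵐ z ∂(P.prod (PoissonMalliavin.intensity ν T)),
        PoissonMalliavin.D hL.toLp hD z
          = φ (F z.1 + PoissonMalliavin.D F hF z) - φ (F z.1) := by
  have hx : (F, PoissonMalliavin.D F hF) ∈ (PoissonMalliavin.cylGraph H p
      (PoissonMalliavin.intensity ν T) P).topologicalClosure := by
    rw [← hp.graph_malliavin]
    exact LinearPMap.mem_graph _ ⟨F, hF⟩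
  have hy := hp.chainPair_mem_closure hφ hx
  rw [← hp.graph_malliavin, LinearPMap.mem_graph_iff] at hy
  obtain ⟨y, hy1, hy2⟩ := hy
  have hL := PoissonMalliavin.memLp_lipschitz_comp hφ (Lp.memLp F)
  have hyL : (y : Lp H' 2 P) = hL.toLp := hy1
  have hD : hL.toLp ∈ PoissonMalliavin.D12 H' p (PoissonMalliavin.intensity ν T) P := hyL ▸ y.2
  refine ⟨hL, hD, ?_⟩
  have hyD : PoissonMalliavin.D hL.toLp hD
      = (PoissonMalliavin.chainPair hφ (F, PoissonMalliavin.D F hF)).2 := by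
    rw [← hy2, PoissonMalliavin.D]
    congr 1
    exact Subtype.ext hyL.symm
  rw [hyD]
  exact PoissonMalliavin.chainPair_snd_ae hφ _
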